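/- Let $\mathcal A=\{A_1,\dots,A_d\}$ be a commuting family of complex $n\times n$ matrices. Its joint eigenvalues are the $n$ $d$-tuples of diagonal entries $\big((U^*A_1U)_{ii},\dots,(U^*A_dU)_{ii}\big)$, where $U$ is a unitary matrix for which all $U^*A_kU$ are upper triangular. Let $\boldsymbol\lambda=(\lambda_1,\dots,\lambda_d)$ be a semisimple joint eigenvalue of multiplicity $p\ge 1$, that is, $\boldsymbol\lambda$ appears exactly $p$ times among the joint eigenvalues and $\dim\bigcap_k\ker(A_k-\lambda_kI_n)=p$. Let $X=[X_1\ X_2]$ and $Y=[Y_1\ Y_2]$ in $\mathbb C^{n\times n}$, with $X_1,Y_1\in\mathbb C^{n\times p}$, satisfy $$X_1^*X_1=I_p,\qquad Y^*X=I_n,\qquad Y^*A_kX=\begin{bmatrix}\lambda_kI_p&0\\0&A_{22}^{(k)}\end{bmatrix},\quad k=1,\dots,d.$$ For $\mu\in\mathbb C^d$ write $A_{22}(\mu)=\sum_k\mu_kA_{22}^{(k)}$ and $\lambda(\mu)=\sum_k\mu_k\lambda_k$. Suppose that $\|\mu\|_2=1$ and that $\lambda(\mu)$ is not an eigenvalue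 of $A_{22}(\mu)$, and set $$D_k(\mu)=\big(A_{22}^{(k)}-\lambda_kI_{n-p}\big)\big(A_{22}(\mu)-\lambda(\mu)I_{n-p}\big)^{-1}.$$ Then there is a constant $C$, depending only on $A_1,\dots,A_d,\boldsymbol\lambda,X,Y,\mu$, such that the following holds for all $\epsilon>0$ and all $E_1,\dots,E_d\in\mathbb C^{n\times n}$ with $\|E_1\|_F^2+\dots+\|E_d\|_F^2=1$. Let $\widetilde A_k=A_k+\epsilon E_k$ and $\widetilde A(\mu)=\sum_k\mu_k\widetilde A_k$, and suppose that $p$ eigenvalues of $\widetilde A(\mu)$ closest to $\lambda(\mu)$ (counted with algebraic multiplicity) are semisimple. Let the columns of $\widetilde X_1=[\widetilde x_1\ \cdots\ \widetilde x_p]$ and $\widetilde Y_1=[\widetilde y_1\ \cdots\ \widetilde y_p]$ be corresponding right and left eigenvectors of $\widetilde A(\mu)$, normalized such that $\widetilde Y_1^*\widetilde X_1=I_p$ and $\|\widetilde x_i\|_2=1$ for all $i$. Then, for every $i=1,\dots,p$ and $k=1,\dots,d$, $$|\widetilde x_i^*\widetilde A_k\widetilde x_i-\lambda_k|\le\big(\|E_k\|_2+\|X_2\|_2\|Y_2\|_2\|D_k(\mu)\|_2\big)\epsilon+C\epsilon^2,$$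 $$|\widetilde y_i^*\widetilde A_k\widetilde x_i-\lambda_k|\le\|\widetilde y_i\|_2\|E_k\|_2\,\epsilon+C\|\widetilde y_i\|_2\,\epsilon^2.$$ In particular, the last term is $\mathcal O(\epsilon^2)$ as long as $\|\widetilde y_i\|_2$ stays bounded. -/

import Mathlib

open scoped Matrix Matrix.Norms.L2Operator

namespace JointEig

/-- The linear combination `∑ k, μ k • A k`; used for matrices, `A(μ)`, and for scalars, `λ(μ)`. -/
def linComb {d : ℕ} {M : Type*} [AddCommMonoid M] [Module ℂ M]
    (μ : EuclideanSpace ℂ (Fin d)) (A : Fin d → M) : M :=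
  ∑ k, μ k • A k

/-- `Λ 0, …, Λ (n-1)` is the list of joint eigenvalues of the family `A` (with repetitions):
the tuples of diagonal entries of `Uᴴ * A k * U` for a unitary `U` that makes all of these
matrices upper triangular. -/
def IsJointEigenvalueList {n d : ℕ} (A : Fin d → Matrix (Fin n) (Fin n) ℂ)
    (Λ : Fin n → Fin d → ℂ) : Prop :=
  ∃ U ∈ Matrix.unitaryGroup (Fin n) ℂ, ∀ k,
    (Uᴴ * A k * U).BlockTriangular id ∧ ∀ i, Λ i k = (Uᴴ * A k * U) i i

/-- The common right eigenspace `⋂ k, ker (A k - lam k • 1)`. -/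
noncomputable def commonEigenspace {n d : ℕ} (A : Fin d → Matrix (Fin n) (Fin n) ℂ)
    (lam : Fin d → ℂ) : Submodule ℂ (Fin n → ℂ) :=
  ⨅ k, LinearMap.ker (Matrix.toLin' (A k - lam k • (1 : Matrix (Fin n) (Fin n) ℂ)))

/-- `lam` is a semisimple joint eigenvalue of multiplicity `p`: it occurs `p ≥ 1` times in the
list of joint eigenvalues, and the common eigenspace has dimension `p`. -/
def IsSemisimpleJointEigenvalue {n d : ℕ} (A : Fin d → Matrix (Fin n) (Fin n) ℂ)
    (lam : Fin d → ℂ) (p : ℕ) : Prop :=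
  0 < p ∧
  (∃ Λ : Fin n → Fin d → ℂ, IsJointEigenvalueList A Λ ∧ Nat.card {i : Fin n // Λ i = lam} = p) ∧
  Module.finrank ℂ (commonEigenspace A lam) = p

/-- The block diagonalization `X₁ᴴ X₁ = I`, `Yᴴ X = I`, `Yᴴ A_k X = diag(λ_k I, A₂₂^(k))`, where
`X = [X₁ X₂]` and `Y = [Y₁ Y₂]` have `n` columns each. -/
def IsBlockDiagonalization {n d p : ℕ} (A : Fin d → Matrix (Fin n) (Fin n) ℂ) (lam : Fin d → ℂ)
    (X₁ Y₁ : Matrix (Fin n) (Fin p) ℂ) (X₂ Y₂ : Matrix (Fin n) (Fin (n - p)) ℂ)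
    (A₂₂ : Fin d → Matrix (Fin (n - p)) (Fin (n - p)) ℂ) : Prop :=
  X₁ᴴ * X₁ = 1 ∧
  (Matrix.fromCols Y₁ Y₂)ᴴ * Matrix.fromCols X₁ X₂ = 1 ∧
  ∀ k, (Matrix.fromCols Y₁ Y₂)ᴴ * A k * Matrix.fromCols X₁ X₂ =
    Matrix.fromBlocks (lam k • (1 : Matrix (Fin p) (Fin p) ℂ)) 0 0 (A₂₂ k)

/-- `D_k(μ) = (A₂₂^(k) - λ_k I) (A₂₂(μ) - λ(μ) I)⁻¹`. -/
noncomputable def Dmat {d q : ℕ} (A₂₂ : Fin d → Matrix (Fin q) (Fin q) ℂ) (lam : Fin d → ℂ)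
    (μ : EuclideanSpace ℂ (Fin d)) (k : Fin d) : Matrix (Fin q) (Fin q) ℂ :=
  (A₂₂ k - lam k • (1 : Matrix (Fin q) (Fin q) ℂ)) *
    (linComb μ A₂₂ - linComb μ lam • (1 : Matrix (Fin q) (Fin q) ℂ))⁻¹

/-- `θ 0, …, θ (p-1)` are `p` eigenvalues of `M`, counted with algebraic multiplicity, that are
closest to `z`: no one of the remaining `n - p` eigenvalues is closer to `z` than any of them. -/
def AreClosestEigenvalues {n p : ℕ} (M : Matrix (Fin n) (Fin n) ℂ) (z : ℂ) (θ : Fin p → ℂ) :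
    Prop :=
  ∃ β : Fin (n - p) → ℂ,
    M.charpoly.roots = Finset.univ.val.map θ + Finset.univ.val.map β ∧
    ∀ i j, ‖θ i - z‖ ≤ ‖β j - z‖

/-- The geometric multiplicity of `t` as an eigenvalue of `M` equals its algebraic one. -/
def IsSemisimpleEigenvalue {n : ℕ} (M : Matrix (Fin n) (Fin n) ℂ) (t : ℂ) : Prop :=
  Module.End.HasEigenvalue (Matrix.toLin' M) t ∧
  Module.finrank ℂ (Module.End.eigenspace (Matrix.toLin' M) t) = M.charpoly.rootMultiplicity t

/-- The Euclidean norm of the `i`-th column of a matrix. -/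
noncomputable def colNorm {n p : ℕ} (X : Matrix (Fin n) (Fin p) ℂ) (i : Fin p) : ℝ :=
  ‖WithLp.toLp 2 (X.col i)‖

/-- The columns of `Xt` and `Yt` are right and left eigenvectors of `M` for those `p` eigenvalues
of `M` that are closest to `z`, these eigenvalues are semisimple, `Ytᴴ * Xt = I`, and
the columns of `Xt` have norm one. -/
def IsNormalizedEigenbasis {n p : ℕ} (M : Matrix (Fin n) (Fin n) ℂ) (z : ℂ)
    (Xt Yt : Matrix (Fin n) (Fin p) ℂ) : Prop :=
  (∃ θ : Fin p → ℂ, AreClosestEigenvalues M z θ ∧ (∀ i, IsSemisimpleEigenvalue M (θ i)) ∧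
    M * Xt = Xt * Matrix.diagonal θ ∧ Ytᴴ * M = Matrix.diagonal θ * Ytᴴ) ∧
  Ytᴴ * Xt = 1 ∧ ∀ i, colNorm Xt i = 1

end JointEig

open Filter Topology Polynomial

namespace JointEig

/-! All the matrices share their off-eigenspace factors: `A k - lam k • 1 = X₂ * H * Y₂ᴴ` with `H =
A₂₂ k - lam k • 1`, and `A(μ) - λ(μ) = X₂ * B * Y₂ᴴ` with `B` invertible; put `G = B⁻¹`. Let `x` be
a unit eigenvector of `A(μ) + ε F`, `‖F‖ ≤ 1`, for `θ`. Applying `Y₂ᴴ` to the eigenvalue equation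
controls `b = Y₂ᴴ x` through `B b = (θ - λ(μ)) b - ε Y₂ᴴ F x`. Once `|θ - λ(μ)| ‖G‖ ≤ 1/2`, this
gives `b = O(ε)`, hence `θ - λ(μ) = O(ε)`, hence `H b = -ε (H G) Y₂ᴴ F x + O(ε²)` with `H G =
D_k(μ)`: the one-sided bound (`norm_rayleigh_le`). A left eigenvector `y` satisfies `yᴴ X₂ = O(ε
‖y‖)` likewise, so `yᴴ X₂ H Y₂ᴴ x` is a product of two small factors (`norm_two_sided_rayleigh_le`).

Continuity of eigenvalues (`eventually_norm_sub_lt`) makes `θ` close enough for `ε` below some `ε₀`;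
for `ε ≥ ε₀` a crude bound is absorbed into `C ε²`. -/

/-- The `i`-th column of a matrix, as a matrix with one column. -/
def colMat {n p : ℕ} (X : Matrix (Fin n) (Fin p) ℂ) (i : Fin p) : Matrix (Fin n) (Fin 1) ℂ :=
  X.submatrix id fun _ => i

lemma norm_of_fin_one (M : Matrix (Fin 1) (Fin 1) ℂ) : ‖M‖ = ‖M 0 0‖ := by
  have h : M = Matrix.diagonal fun _ => M 0 0 := by
    ext i j
    rw [Subsingleton.elim i 0, Subsingleton.elim j 0, Matrix.diagonal_apply_eq]
  rw [h, Matrix.l2_opNorm_diagonal, pi_norm_const]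
  simp

lemma norm_colMat {n p : ℕ} (X : Matrix (Fin n) (Fin p) ℂ) (i : Fin p) :
    ‖colMat X i‖ = colNorm X i := by
  have h : ‖colMat X i‖ * ‖colMat X i‖ = colNorm X i ^ 2 := by
    rw [← Matrix.l2_opNorm_conjTranspose_mul_self, norm_of_fin_one, colNorm,
      EuclideanSpace.norm_sq_eq]
    have : ((colMat X i)ᴴ * colMat X i) 0 0 = ((∑ j, ‖X j i‖ ^ 2 : ℝ) : ℂ) := by
      simp [Matrix.mul_apply, colMat, Complex.conj_mul']
    rw [this, Complex.norm_real, Real.norm_of_nonneg (by positivity)]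
    simp
  rw [← sq] at h
  exact (pow_left_inj₀ (norm_nonneg _) (norm_nonneg _) two_ne_zero).1 h

lemma conjTranspose_mul_mul_apply {n p : ℕ} (Y X : Matrix (Fin n) (Fin p) ℂ)
    (M : Matrix (Fin n) (Fin n) ℂ) (i : Fin p) :
    (Yᴴ * M * X) i i = ((colMat Y i)ᴴ * M * colMat X i) 0 0 := by
  simp [Matrix.mul_apply, colMat]

lemma conjTranspose_mul_apply {n p : ℕ} (Y X : Matrix (Fin n) (Fin p) ℂ) (i : Fin p) :
    (Yᴴ * X) i i = ((colMat Y i)ᴴ * colMat X i) 0 0 := by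
  simp [Matrix.mul_apply, colMat]

lemma norm_sq_le_sum_norm_sq {m n : ℕ} (E : Matrix (Fin m) (Fin n) ℂ) :
    ‖E‖ ^ 2 ≤ ∑ i, ∑ j, ‖E i j‖ ^ 2 := by
  have h : ‖E‖ ≤ √(∑ i, ∑ j, ‖E i j‖ ^ 2) := by
    rw [Matrix.l2_opNorm_def]
    refine ContinuousLinearMap.opNorm_le_bound _ (Real.sqrt_nonneg _) fun x => ?_
    rw [EuclideanSpace.norm_eq, EuclideanSpace.norm_eq, ← Real.sqrt_mul (by positivity),
      Finset.sum_mul]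
    refine Real.sqrt_le_sqrt (Finset.sum_le_sum fun i _ => ?_)
    calc _ = ‖∑ j, E i j * x j‖ ^ 2 := rfl
      _ ≤ (∑ j, ‖E i j‖ * ‖x j‖) ^ 2 := by
        gcongr
        exact (norm_sum_le _ _).trans_eq (by simp)
      _ ≤ _ := Finset.sum_mul_sq_le_sq_mul_sq _ _ _
  calc _ ≤ √(∑ i, ∑ j, ‖E i j‖ ^ 2) ^ 2 := by gcongr
    _ = _ := Real.sq_sqrt (by positivity)

/-- Cauchy–Schwarz in `k`, with the spectral norm below the Frobenius norm. It keeps all later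
constants independent of `E`. -/
lemma norm_linComb_le_one {n d : ℕ} {μ : EuclideanSpace ℂ (Fin d)} (hμ : ‖μ‖ = 1)
    {E : Fin d → Matrix (Fin n) (Fin n) ℂ} (hE : ∑ k, ∑ i, ∑ j, ‖E k i j‖ ^ 2 = 1) :
    ‖linComb μ E‖ ≤ 1 := by
  have h1 : ∑ k, ‖μ k‖ ^ 2 = 1 := by rw [← EuclideanSpace.norm_sq_eq, hμ, one_pow]
  have h2 : ∑ k, ‖E k‖ ^ 2 ≤ 1 :=
    (Finset.sum_le_sum fun k _ => norm_sq_le_sum_norm_sq (E k)).trans_eq hE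
  have h3 : ‖linComb μ E‖ ≤ ∑ k, ‖μ k‖ * ‖E k‖ :=
    (norm_sum_le _ _).trans_eq (by simp [norm_smul])
  have h4 : (∑ k, ‖μ k‖ * ‖E k‖) ^ 2 ≤ 1 := by
    refine (Finset.sum_mul_sq_le_sq_mul_sq _ _ _).trans ?_
    rw [h1, one_mul]
    exact h2
  exact h3.trans (abs_le_of_sq_le_sq' (by simpa using h4) zero_le_one).2

lemma linComb_sub_smul_one {n d : ℕ} (μ : EuclideanSpace ℂ (Fin d))
    (A : Fin d → Matrix (Fin n) (Fin n) ℂ) (lam : Fin d → ℂ) :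
    linComb μ A - linComb μ lam • (1 : Matrix (Fin n) (Fin n) ℂ) =
      linComb μ fun k => A k - lam k • (1 : Matrix (Fin n) (Fin n) ℂ) := by
  simp [linComb, smul_sub, Finset.sum_sub_distrib, Finset.sum_smul, mul_smul]

lemma linComb_mul_mul {m n d : ℕ} (μ : EuclideanSpace ℂ (Fin d))
    (B : Fin d → Matrix (Fin n) (Fin n) ℂ) (X : Matrix (Fin m) (Fin n) ℂ)
    (Y : Matrix (Fin n) (Fin m) ℂ) :
    linComb μ (fun k => X * B k * Y) = X * linComb μ B * Y := by
  simp [linComb, Matrix.mul_sum, Matrix.sum_mul]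

lemma linComb_add_smul {n d : ℕ} (μ : EuclideanSpace ℂ (Fin d))
    (A E : Fin d → Matrix (Fin n) (Fin n) ℂ) (t : ℂ) :
    linComb μ (fun k => A k + t • E k) = linComb μ A + t • linComb μ E := by
  simp [linComb, Finset.sum_add_distrib, Finset.smul_sum, smul_comm t]

/-! ### Consequences of the block diagonalization -/

namespace IsBlockDiagonalization

variable {n d p : ℕ} {A : Fin d → Matrix (Fin n) (Fin n) ℂ} {lam : Fin d → ℂ}
  {X₁ Y₁ : Matrix (Fin n) (Fin p) ℂ} {X₂ Y₂ : Matrix (Fin n) (Fin (n - p)) ℂ}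
  {A₂₂ : Fin d → Matrix (Fin (n - p)) (Fin (n - p)) ℂ}

lemma conjTranspose_mul_self_right (h : IsBlockDiagonalization A lam X₁ Y₁ X₂ Y₂ A₂₂) :
    Y₂ᴴ * X₂ = 1 := by
  have h2 := h.2.1
  rw [Matrix.conjTranspose_fromCols_eq_fromRows_conjTranspose, Matrix.fromRows_mul_fromCols,
    ← Matrix.fromBlocks_one, Matrix.fromBlocks_inj] at h2
  exact h2.2.2.2

lemma mul_conjTranspose (h : IsBlockDiagonalization A lam X₁ Y₁ X₂ Y₂ A₂₂) (hp : p ≤ n) :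
    Matrix.fromCols X₁ X₂ * (Matrix.fromCols Y₁ Y₂)ᴴ = 1 :=
  (Matrix.mul_eq_one_comm_of_card_eq _ _ _ (by simp [hp])).1 h.2.1

lemma eq_mul_mul (h : IsBlockDiagonalization A lam X₁ Y₁ X₂ Y₂ A₂₂) (hp : p ≤ n) (k : Fin d) :
    A k = Matrix.fromCols X₁ X₂ *
      Matrix.fromBlocks (lam k • (1 : Matrix (Fin p) (Fin p) ℂ)) 0 0 (A₂₂ k) *
        (Matrix.fromCols Y₁ Y₂)ᴴ := by
  have hXY := h.mul_conjTranspose hp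
  calc A k = (Matrix.fromCols X₁ X₂ * (Matrix.fromCols Y₁ Y₂)ᴴ) * A k *
        (Matrix.fromCols X₁ X₂ * (Matrix.fromCols Y₁ Y₂)ᴴ) := by simp [hXY]
    _ = _ := by rw [← h.2.2 k]; simp only [Matrix.mul_assoc]

/-- Writing `1 = X₁ Y₁ᴴ + X₂ Y₂ᴴ` cancels the `X₁` block. -/
lemma sub_smul_one (h : IsBlockDiagonalization A lam X₁ Y₁ X₂ Y₂ A₂₂) (hp : p ≤ n) (k : Fin d) :
    A k - lam k • (1 : Matrix (Fin n) (Fin n) ℂ) =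
      X₂ * (A₂₂ k - lam k • (1 : Matrix (Fin (n - p)) (Fin (n - p)) ℂ)) * Y₂ᴴ := by
  have hXY := h.mul_conjTranspose hp
  have hA := h.eq_mul_mul hp k
  rw [Matrix.conjTranspose_fromCols_eq_fromRows_conjTranspose] at hXY hA
  rw [Matrix.fromCols_mul_fromBlocks, Matrix.fromCols_mul_fromRows] at hA
  rw [Matrix.fromCols_mul_fromRows] at hXY
  rw [hA, ← hXY]
  simp [Matrix.mul_sub, Matrix.sub_mul]

lemma linComb_sub_smul_one (h : IsBlockDiagonalization A lam X₁ Y₁ X₂ Y₂ A₂₂) (hp : p ≤ n)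
    (μ : EuclideanSpace ℂ (Fin d)) :
    linComb μ A - linComb μ lam • (1 : Matrix (Fin n) (Fin n) ℂ) =
      X₂ * (linComb μ A₂₂ - linComb μ lam • (1 : Matrix (Fin (n - p)) (Fin (n - p)) ℂ)) * Y₂ᴴ := by
  simp only [JointEig.linComb_sub_smul_one, h.sub_smul_one hp, linComb_mul_mul]

lemma linComb_conjTranspose_mul (h : IsBlockDiagonalization A lam X₁ Y₁ X₂ Y₂ A₂₂)
    (μ : EuclideanSpace ℂ (Fin d)) :
    (Matrix.fromCols Y₁ Y₂)ᴴ * (linComb μ A * Matrix.fromCols X₁ X₂) =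
      Matrix.fromBlocks (linComb μ lam • (1 : Matrix (Fin p) (Fin p) ℂ)) 0 0 (linComb μ A₂₂) := by
  have hk (k : Fin d) : (Matrix.fromCols Y₁ Y₂)ᴴ * (A k * Matrix.fromCols X₁ X₂) =
      Matrix.fromBlocks (lam k • (1 : Matrix (Fin p) (Fin p) ℂ)) 0 0 (A₂₂ k) := by
    rw [← Matrix.mul_assoc, h.2.2 k]
  simp only [linComb, Matrix.sum_mul, Matrix.mul_sum, Matrix.smul_mul, Matrix.mul_smul, hk]
  ext (i | i) (j | j) <;> simp [Matrix.sum_apply, Finset.sum_mul, mul_assoc]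

/-- `A(μ) = (A(μ) X) Yᴴ` has the characteristic polynomial of the swapped product `Yᴴ A(μ) X`, which
is block diagonal. -/
lemma pow_dvd_charpoly (h : IsBlockDiagonalization A lam X₁ Y₁ X₂ Y₂ A₂₂) (hp : p ≤ n)
    (μ : EuclideanSpace ℂ (Fin d)) :
    (X - C (linComb μ lam)) ^ p ∣ (linComb μ A).charpoly := by
  have h1 : linComb μ A = (linComb μ A * Matrix.fromCols X₁ X₂) * (Matrix.fromCols Y₁ Y₂)ᴴ := by
    rw [Matrix.mul_assoc, h.mul_conjTranspose hp, Matrix.mul_one]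
  rw [h1, Matrix.charpoly_mul_comm_of_le _ _ (by simp [hp]), h.linComb_conjTranspose_mul,
    Matrix.charpoly_fromBlocks_zero₁₂, Matrix.smul_one_eq_diagonal, Matrix.charpoly_diagonal]
  simp only [Finset.prod_const, Finset.card_univ, Fintype.card_fin]
  exact (Dvd.intro _ rfl).mul_left _

end IsBlockDiagonalization

/-! ### Continuity of the closest eigenvalues -/

lemma AreClosestEigenvalues.exists_norm_le {n p : ℕ} {N : Matrix (Fin n) (Fin n) ℂ} {z : ℂ}
    {θ : Fin p → ℂ} (h : AreClosestEigenvalues N z θ) :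
    ∃ β : Fin (n - p) → ℂ, (∀ i j, ‖θ i - z‖ ≤ ‖β j - z‖) ∧
      (∀ i, ‖θ i‖ ≤ ‖N‖ * ‖(1 : Matrix (Fin n) (Fin n) ℂ)‖) ∧
      (∀ j, ‖β j‖ ≤ ‖N‖ * ‖(1 : Matrix (Fin n) (Fin n) ℂ)‖) ∧
      N.charpoly = (∏ i, (X - C (θ i))) * ∏ j, (X - C (β j)) := by
  obtain ⟨β, hr, hle⟩ := h
  have hb : ∀ w ∈ N.charpoly.roots, ‖w‖ ≤ ‖N‖ * ‖(1 : Matrix (Fin n) (Fin n) ℂ)‖ := fun w hw =>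
    spectrum.norm_le_norm_mul_of_mem (Matrix.mem_spectrum_of_isRoot_charpoly (isRoot_of_mem_roots hw))
  refine ⟨β, hle, fun i => hb _ ?_, fun j => hb _ ?_, ?_⟩
  · rw [hr]; simp
  · rw [hr]; simp
  · rw [(IsAlgClosed.splits N.charpoly).eq_prod_roots_of_monic (Matrix.charpoly_monic N), hr]
    simp only [Multiset.map_add, Multiset.map_map, Multiset.prod_add]
    rfl

/-- Continuity of eigenvalues: if `z` is an eigenvalue of `M` of algebraic multiplicity at least
`p`, then the `p` eigenvalues closest to `z` of matrices near `M` are near `z`. -/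
lemma eventually_norm_sub_lt {n p : ℕ} {M : Matrix (Fin n) (Fin n) ℂ} {z : ℂ}
    (hM : (X - C z) ^ p ∣ M.charpoly) {δ : ℝ} (hδ : 0 < δ) :
    ∀ᶠ N in 𝓝 M, ∀ θ : Fin p → ℂ, AreClosestEigenvalues N z θ → ∀ i, ‖θ i - z‖ < δ := by
  suffices h : ∀ i : Fin p, ∀ᶠ N in 𝓝 M, ∀ θ : Fin p → ℂ, AreClosestEigenvalues N z θ →
      ‖θ i - z‖ < δ by
    filter_upwards [eventually_all.2 h] with N hN θ hθ i using hN i θ hθ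
  intro i
  by_contra hcon
  obtain ⟨N, hN, hcon⟩ := exists_seq_forall_of_frequently (not_eventually.1 hcon)
  push Not at hcon
  choose θ hθ hδθ using hcon
  choose β hθβ hθN hβN hprod using fun m => (hθ m).exists_norm_le
  obtain ⟨K, hK⟩ := hN.norm.bddAbove_range
  set R := K * ‖(1 : Matrix (Fin n) (Fin n) ℂ)‖
  have hNR (m : ℕ) : ‖N m‖ * ‖(1 : Matrix (Fin n) (Fin n) ℂ)‖ ≤ R :=
    mul_le_mul_of_nonneg_right (hK ⟨m, rfl⟩) (norm_nonneg _)
  have hR : 0 ≤ R := le_trans (by positivity) (hNR 0)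
  -- All eigenvalues stay in one ball, so a subsequence of them converges; the limits turn out to be
  -- the roots of `M.charpoly`.
  obtain ⟨⟨θ', β'⟩, -, φ, hφ, hlim⟩ := tendsto_subseq_of_bounded
    (x := fun m => (θ m, β m)) (Metric.isBounded_closedBall (x := 0) (r := R)) (fun m => by
      rw [mem_closedBall_zero_iff, Prod.norm_def, max_le_iff, pi_norm_le_iff_of_nonneg hR,
        pi_norm_le_iff_of_nonneg hR]
      exact ⟨fun i => (hθN m i).trans (hNR m), fun j => (hβN m j).trans (hNR m)⟩)
  rw [Prod.tendsto_iff, tendsto_pi_nhds, tendsto_pi_nhds] at hlim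
  obtain ⟨hlimθ, hlimβ⟩ := hlim
  have hθi : δ ≤ ‖θ' i - z‖ :=
    ge_of_tendsto' ((hlimθ i).sub_const z).norm fun m => hδθ (φ m)
  have hβj (j) : δ ≤ ‖β' j - z‖ :=
    ge_of_tendsto' ((hlimβ j).sub_const z).norm fun m => (hδθ (φ m)).trans (hθβ (φ m) i j)
  have hchar : M.charpoly = (∏ i, (X - C (θ' i))) * ∏ j, (X - C (β' j)) := by
    refine Polynomial.funext fun w => ?_
    have h1 : Tendsto (fun m => (N (φ m)).charpoly.eval w) atTop (𝓝 (M.charpoly.eval w)) := by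
      simp only [Matrix.eval_charpoly]
      have hc : Continuous fun L : Matrix (Fin n) (Fin n) ℂ =>
        (Matrix.scalar (Fin n) w - L).det := (continuous_const.sub continuous_id).matrix_det
      exact (hc.tendsto M).comp (hN.comp hφ.tendsto_atTop)
    refine tendsto_nhds_unique h1 ?_
    simp only [hprod, eval_mul, eval_prod, eval_sub, eval_X, eval_C]
    exact (tendsto_finsetProd _ fun i _ => (hlimθ i).const_sub w).mul
      (tendsto_finsetProd _ fun j _ => (hlimβ j).const_sub w)
  have hcop {w : ℂ} (hw : δ ≤ ‖w - z‖) : IsCoprime ((X - C z) ^ p) (X - C w) := by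
    refine (isCoprime_X_sub_C_of_isUnit_sub ?_).pow_left
    rw [isUnit_iff_ne_zero, sub_ne_zero]
    rintro rfl
    simp at hw
    linarith
  rw [hchar] at hM
  -- Every `β' j`, and `θ' i` too, is at least `δ` from `z`. So `(X - C z) ^ p` would divide a
  -- product of only `p - 1` linear factors.
  have hdvd := (IsCoprime.prod_right fun j _ => hcop (hβj j)).dvd_of_dvd_mul_right hM
  rw [← Finset.mul_prod_erase _ _ (Finset.mem_univ i)] at hdvd
  have hdeg := natDegree_le_of_dvd ((hcop hθi).dvd_of_dvd_mul_left hdvd)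
    (Finset.prod_ne_zero_iff.2 fun j _ => X_sub_C_ne_zero (θ' j))
  rw [natDegree_pow, natDegree_X_sub_C, natDegree_finsetProd_X_sub_C_eq_card,
    Finset.card_erase_of_mem (Finset.mem_univ i), Finset.card_fin] at hdeg
  have := i.pos
  omega

/-! ### Perturbed eigenvectors -/

lemma norm_le_of_mul_eq {q : ℕ} {B G : Matrix (Fin q) (Fin q) ℂ} (hGB : G * B = 1) {t s : ℂ}
    (ht : ‖t‖ * ‖G‖ ≤ 1 / 2) {b r : Matrix (Fin q) (Fin 1) ℂ} (h : B * b = t • b - s • r) :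
    ‖b‖ ≤ 2 * ‖G‖ * ‖s‖ * ‖r‖ := by
  have hb : b = t • (G * b) - s • (G * r) := by
    rw [← Matrix.mul_smul, ← Matrix.mul_smul, ← Matrix.mul_sub, ← h, ← Matrix.mul_assoc, hGB,
      Matrix.one_mul]
  have h1 : ‖b‖ ≤ ‖t‖ * (‖G‖ * ‖b‖) + ‖s‖ * (‖G‖ * ‖r‖) := by
    calc ‖b‖ = ‖t • (G * b) - s • (G * r)‖ := congrArg _ hb
      _ ≤ ‖t‖ * ‖G * b‖ + ‖s‖ * ‖G * r‖ := by
        simpa only [norm_smul] using norm_sub_le (t • (G * b)) (s • (G * r))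
      _ ≤ _ := by gcongr <;> exact Matrix.l2_opNorm_mul _ _
  -- The `t` term is at most `‖b‖ / 2` and moves to the left side, whence the factor 2.
  have h2 := mul_le_mul_of_nonneg_right ht (norm_nonneg b)
  nlinarith

lemma norm_mul_mul_le {a b c e : ℕ} (P : Matrix (Fin a) (Fin b) ℂ) (Q : Matrix (Fin b) (Fin c) ℂ)
    (R : Matrix (Fin c) (Fin e) ℂ) : ‖P * Q * R‖ ≤ ‖P‖ * ‖Q‖ * ‖R‖ := by
  grw [Matrix.l2_opNorm_mul, Matrix.l2_opNorm_mul]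

section Perturbation

variable {n q : ℕ} {M F : Matrix (Fin n) (Fin n) ℂ} {z θ s : ℂ} {X Y : Matrix (Fin n) (Fin q) ℂ}
  {B G : Matrix (Fin q) (Fin q) ℂ} {x y : Matrix (Fin n) (Fin 1) ℂ}

lemma mul_conjTranspose_mul_eq (hYX : Yᴴ * X = 1)
    (hM : M - z • (1 : Matrix (Fin n) (Fin n) ℂ) = X * B * Yᴴ) (hx : (M + s • F) * x = θ • x) :
    B * (Yᴴ * x) = (θ - z) • (Yᴴ * x) - s • (Yᴴ * F * x) := by
  have h1 : (M - z • (1 : Matrix (Fin n) (Fin n) ℂ)) * x = (θ - z) • x - s • (F * x) := by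
    rw [sub_smul, ← hx]
    simp only [Matrix.add_mul, Matrix.sub_mul, Matrix.smul_mul, Matrix.one_mul]
    abel
  calc B * (Yᴴ * x) = (Yᴴ * X) * (B * (Yᴴ * x)) := by rw [hYX, Matrix.one_mul]
    _ = Yᴴ * ((M - z • (1 : Matrix (Fin n) (Fin n) ℂ)) * x) := by
      rw [hM]; simp only [Matrix.mul_assoc]
    _ = _ := by rw [h1]; simp only [Matrix.mul_sub, Matrix.mul_smul, Matrix.mul_assoc]

/-- The component of a perturbed right eigenvector outside the unperturbed eigenspace. -/
lemma norm_conjTranspose_mul_le (hYX : Yᴴ * X = 1)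
    (hM : M - z • (1 : Matrix (Fin n) (Fin n) ℂ) = X * B * Yᴴ) (hGB : G * B = 1) (hF : ‖F‖ ≤ 1)
    (ht : ‖θ - z‖ * ‖G‖ ≤ 1 / 2) (hx : (M + s • F) * x = θ • x) :
    ‖Yᴴ * x‖ ≤ 2 * ‖G‖ * ‖Y‖ * ‖s‖ * ‖x‖ := by
  calc ‖Yᴴ * x‖ ≤ 2 * ‖G‖ * ‖s‖ * ‖Yᴴ * F * x‖ :=
        norm_le_of_mul_eq hGB ht (mul_conjTranspose_mul_eq hYX hM hx)
    _ ≤ 2 * ‖G‖ * ‖s‖ * (‖Y‖ * 1 * ‖x‖) := by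
      grw [norm_mul_mul_le, Matrix.l2_opNorm_conjTranspose, hF]
    _ = _ := by ring

/-- The component of a perturbed left eigenvector outside the unperturbed eigenspace. -/
lemma norm_conjTranspose_mul_le' (hYX : Yᴴ * X = 1)
    (hM : M - z • (1 : Matrix (Fin n) (Fin n) ℂ) = X * B * Yᴴ) (hBG : B * G = 1) (hF : ‖F‖ ≤ 1)
    (ht : ‖θ - z‖ * ‖G‖ ≤ 1 / 2) (hy : yᴴ * (M + s • F) = θ • yᴴ) :
    ‖yᴴ * X‖ ≤ 2 * ‖G‖ * ‖X‖ * ‖s‖ * ‖y‖ := by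
  -- Taking adjoints turns `y` into a right eigenvector and exchanges `X` with `Y`.
  have h := norm_conjTranspose_mul_le (M := Mᴴ) (F := Fᴴ) (X := Y) (Y := X) (B := Bᴴ) (G := Gᴴ)
    (z := star z) (θ := star θ) (s := star s) (x := y)
    (by rw [← Matrix.conjTranspose_conjTranspose Y, ← Matrix.conjTranspose_mul, hYX,
      Matrix.conjTranspose_one])
    (by
      have := congrArg Matrix.conjTranspose hM
      simpa [Matrix.mul_assoc] using this)
    (by rw [← Matrix.conjTranspose_mul, hBG, Matrix.conjTranspose_one])
    (by rwa [Matrix.l2_opNorm_conjTranspose])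
    (by rwa [Matrix.l2_opNorm_conjTranspose, ← star_sub, norm_star])
    (by
      have := congrArg Matrix.conjTranspose hy
      simpa using this)
  rw [Matrix.l2_opNorm_conjTranspose, norm_star] at h
  rwa [← Matrix.l2_opNorm_conjTranspose, Matrix.conjTranspose_mul,
    Matrix.conjTranspose_conjTranspose]

/-- Bootstrap: `(θ - z) x = X B (Yᴴ x) + s F x`, where `Yᴴ x` is already `O(s)`, sharpens mere
closeness of `θ` to first order. -/
lemma norm_eigenvalue_sub_le (hYX : Yᴴ * X = 1)
    (hM : M - z • (1 : Matrix (Fin n) (Fin n) ℂ) = X * B * Yᴴ) (hGB : G * B = 1) (hF : ‖F‖ ≤ 1)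
    (ht : ‖θ - z‖ * ‖G‖ ≤ 1 / 2) (hx : (M + s • F) * x = θ • x) (hx1 : ‖x‖ = 1) :
    ‖θ - z‖ ≤ (‖X‖ * ‖B‖ * (2 * ‖G‖ * ‖Y‖) + 1) * ‖s‖ := by
  have hb := norm_conjTranspose_mul_le hYX hM hGB hF ht hx
  have h1 : (θ - z) • x = X * B * (Yᴴ * x) + s • (F * x) := by
    rw [← Matrix.mul_assoc, ← hM, sub_smul, ← hx]
    simp only [Matrix.add_mul, Matrix.sub_mul, Matrix.smul_mul, Matrix.one_mul]
    abel
  calc ‖θ - z‖ = ‖(θ - z) • x‖ := by rw [norm_smul, hx1, mul_one]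
    _ ≤ ‖X * B * (Yᴴ * x)‖ + ‖s‖ * ‖F * x‖ := by
      rw [h1, ← norm_smul]; exact norm_add_le _ _
    _ ≤ ‖X‖ * ‖B‖ * (2 * ‖G‖ * ‖Y‖ * ‖s‖ * 1) + ‖s‖ * (1 * 1) := by
      grw [norm_mul_mul_le, hb, Matrix.l2_opNorm_mul, hF, hx1]
    _ = _ := by ring

/-- First order bound for `xᴴ A x`, where `A - l • 1 = X * H * Yᴴ`. -/
lemma norm_rayleigh_le (hYX : Yᴴ * X = 1)
    (hM : M - z • (1 : Matrix (Fin n) (Fin n) ℂ) = X * B * Yᴴ) (hGB : G * B = 1) (hF : ‖F‖ ≤ 1)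
    (ht : ‖θ - z‖ * ‖G‖ ≤ 1 / 2) (hx : (M + s • F) * x = θ • x) (hx1 : ‖x‖ = 1)
    (H : Matrix (Fin q) (Fin q) ℂ) :
    ‖xᴴ * (X * H * Yᴴ) * x‖ ≤ ‖X‖ * ‖Y‖ * ‖H * G‖ * ‖s‖ +
      ‖X‖ * ‖H‖ * ‖G‖ * (‖X‖ * ‖B‖ * (2 * ‖G‖ * ‖Y‖) + 1) * (2 * ‖G‖ * ‖Y‖) * ‖s‖ ^ 2 := by
  have hb := norm_conjTranspose_mul_le hYX hM hGB hF ht hx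
  have hθ := norm_eigenvalue_sub_le hYX hM hGB hF ht hx hx1
  have hB := mul_conjTranspose_mul_eq hYX hM hx
  set t := θ - z
  set K := ‖X‖ * ‖B‖ * (2 * ‖G‖ * ‖Y‖) + 1
  -- Inserting `G * B = 1` after `H` makes `‖H * G‖` the first-order coefficient, rather than `‖H‖ *
  -- ‖G‖`.
  have hHb : H * (Yᴴ * x) = t • (H * G * (Yᴴ * x)) - s • (H * G * (Yᴴ * F * x)) := by
    rw [← Matrix.mul_smul (H * G) t, ← Matrix.mul_smul (H * G) s, ← Matrix.mul_sub, ← hB,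
      Matrix.mul_assoc,
      ← Matrix.mul_assoc G, hGB, Matrix.one_mul]
  have h1 : ‖H * (Yᴴ * x)‖ ≤ (K * ‖s‖) * (‖H‖ * ‖G‖ * (2 * ‖G‖ * ‖Y‖ * ‖s‖ * 1)) +
      ‖s‖ * (‖H * G‖ * (‖Y‖ * 1 * 1)) := by
    calc _ ≤ ‖t‖ * ‖H * G * (Yᴴ * x)‖ + ‖s‖ * ‖H * G * (Yᴴ * F * x)‖ := by
          rw [hHb, ← norm_smul, ← norm_smul]; exact norm_sub_le _ _
      _ ≤ _ := by
        grw [norm_mul_mul_le, hb, hθ, hx1, Matrix.l2_opNorm_mul, norm_mul_mul_le,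
          Matrix.l2_opNorm_conjTranspose, hF, hx1]
  calc _ = ‖xᴴ * X * (H * (Yᴴ * x))‖ := by simp only [Matrix.mul_assoc]
    _ ≤ 1 * ‖X‖ * ‖H * (Yᴴ * x)‖ := by
      grw [norm_mul_mul_le, Matrix.l2_opNorm_conjTranspose, hx1]
    _ ≤ 1 * ‖X‖ * ((K * ‖s‖) * (‖H‖ * ‖G‖ * (2 * ‖G‖ * ‖Y‖ * ‖s‖ * 1)) +
      ‖s‖ * (‖H * G‖ * (‖Y‖ * 1 * 1))) := by grw [h1]
    _ = _ := by ring

/-- Second order bound for `yᴴ A x`, where `A - l • 1 = X * H * Yᴴ`. -/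
lemma norm_two_sided_rayleigh_le (hYX : Yᴴ * X = 1)
    (hM : M - z • (1 : Matrix (Fin n) (Fin n) ℂ) = X * B * Yᴴ) (hGB : G * B = 1)
    (hBG : B * G = 1) (hF : ‖F‖ ≤ 1) (ht : ‖θ - z‖ * ‖G‖ ≤ 1 / 2)
    (hx : (M + s • F) * x = θ • x) (hx1 : ‖x‖ = 1) (hy : yᴴ * (M + s • F) = θ • yᴴ)
    (H : Matrix (Fin q) (Fin q) ℂ) :
    ‖yᴴ * (X * H * Yᴴ) * x‖ ≤
      (2 * ‖G‖ * ‖X‖) * ‖H‖ * (2 * ‖G‖ * ‖Y‖) * ‖y‖ * ‖s‖ ^ 2 := by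
  have hb := norm_conjTranspose_mul_le hYX hM hGB hF ht hx
  have hc := norm_conjTranspose_mul_le' hYX hM hBG hF ht hy
  calc _ = ‖yᴴ * X * H * (Yᴴ * x)‖ := by simp only [Matrix.mul_assoc]
    _ ≤ 2 * ‖G‖ * ‖X‖ * ‖s‖ * ‖y‖ * ‖H‖ * (2 * ‖G‖ * ‖Y‖ * ‖s‖ * 1) := by
      grw [norm_mul_mul_le, hb, hc, hx1]
    _ = _ := by ring

end Perturbation

lemma det_sub_smul_one_ne_zero {q : ℕ} {M : Matrix (Fin q) (Fin q) ℂ} {z : ℂ}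
    (h : ¬ Module.End.HasEigenvalue (Matrix.toLin' M) z) :
    (M - z • (1 : Matrix (Fin q) (Fin q) ℂ)).det ≠ 0 := by
  intro hdet
  obtain ⟨v, hv, hMv⟩ := Matrix.exists_mulVec_eq_zero_iff.2 hdet
  refine h (Module.End.hasEigenvalue_of_hasEigenvector (x := v)
    (Module.End.hasEigenvector_iff.2 ⟨?_, hv⟩))
  rw [Module.End.mem_eigenspace_iff, Matrix.toLin'_apply, ← sub_eq_zero, ← hMv, Matrix.sub_mulVec,
    Matrix.smul_mulVec, Matrix.one_mulVec]

/-- As `yᴴ x = 1`, the shift by `l` passes inside the form. Serves both quotients, with `Y = X` for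
the one-sided one. -/
lemma norm_entry_sub_le {n p : ℕ} {A E : Matrix (Fin n) (Fin n) ℂ} {l : ℂ} {ε : ℝ} (hε : 0 < ε)
    {Y X : Matrix (Fin n) (Fin p) ℂ} {i : Fin p} (hYX : (Yᴴ * X) i i = 1)
    (hX : colNorm X i = 1) :
    ‖(Yᴴ * (A + (ε : ℂ) • E) * X) i i - l‖ ≤
      ‖(colMat Y i)ᴴ * (A - l • (1 : Matrix (Fin n) (Fin n) ℂ)) * colMat X i‖ +
        colNorm Y i * ‖E‖ * ε := by
  rw [conjTranspose_mul_apply] at hYX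
  rw [conjTranspose_mul_mul_apply]
  set x := colMat X i with hx
  set y := colMat Y i with hy
  have h1 : yᴴ * (A + (ε : ℂ) • E) * x =
      yᴴ * (A - l • (1 : Matrix (Fin n) (Fin n) ℂ)) * x + (ε : ℂ) • (yᴴ * E * x) +
        l • (yᴴ * x) := by
    simp only [Matrix.mul_add, Matrix.mul_sub, Matrix.add_mul, Matrix.sub_mul, Matrix.mul_smul,
      Matrix.smul_mul, Matrix.mul_one]
    abel
  have h2 : (yᴴ * (A + (ε : ℂ) • E) * x) 0 0 - l =
      (yᴴ * (A - l • (1 : Matrix (Fin n) (Fin n) ℂ)) * x + (ε : ℂ) • (yᴴ * E * x)) 0 0 := by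
    rw [h1, Matrix.add_apply _ (l • _), Matrix.smul_apply, hYX]
    simp
  rw [h2, ← norm_of_fin_one]
  grw [norm_add_le, norm_smul, norm_mul_mul_le _ E, Matrix.l2_opNorm_conjTranspose, hx, hy,
    norm_colMat, norm_colMat, hX]
  simp only [Complex.norm_real, Real.norm_of_nonneg hε.le]
  apply le_of_eq
  ring

lemma conjTranspose_mul_self_apply_of_colNorm {n p : ℕ} {X : Matrix (Fin n) (Fin p) ℂ}
    {i : Fin p} (h : colNorm X i = 1) : (Xᴴ * X) i i = 1 := by
  have h1 : ((X)ᴴ * X) i i = ((∑ j, ‖X j i‖ ^ 2 : ℝ) : ℂ) := by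
    simp [Matrix.mul_apply, Complex.conj_mul']
  have h2 : ∑ j, ‖X j i‖ ^ 2 = colNorm X i ^ 2 := by
    rw [colNorm, EuclideanSpace.norm_sq_eq]
    simp
  rw [h1, h2, h]
  simp

end JointEig

/-! ### Choice of constants and conclusion -/

theorem lemma4 {n d p : ℕ}
    (A : Fin d → Matrix (Fin n) (Fin n) ℂ) (hA : ∀ j k, A j * A k = A k * A j)
    (lam : Fin d → ℂ) (hlam : JointEig.IsSemisimpleJointEigenvalue A lam p)
    (X₁ Y₁ : Matrix (Fin n) (Fin p) ℂ) (X₂ Y₂ : Matrix (Fin n) (Fin (n - p)) ℂ)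
    (A₂₂ : Fin d → Matrix (Fin (n - p)) (Fin (n - p)) ℂ)
    (hXY : JointEig.IsBlockDiagonalization A lam X₁ Y₁ X₂ Y₂ A₂₂)
    (μ : EuclideanSpace ℂ (Fin d)) (hμ : ‖μ‖ = 1)
    (hlamμ : ¬ Module.End.HasEigenvalue (Matrix.toLin' (JointEig.linComb μ A₂₂))
      (JointEig.linComb μ lam)) :
    ∃ C : ℝ, ∀ E : Fin d → Matrix (Fin n) (Fin n) ℂ,
      (∑ k, ∑ i, ∑ j, ‖E k i j‖ ^ 2 = 1) →
      ∀ ε : ℝ, 0 < ε →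
      ∀ At : Fin d → Matrix (Fin n) (Fin n) ℂ, (∀ k, At k = A k + (ε : ℂ) • E k) →
      ∀ Xt Yt : Matrix (Fin n) (Fin p) ℂ,
        JointEig.IsNormalizedEigenbasis (JointEig.linComb μ At) (JointEig.linComb μ lam) Xt Yt →
        ∀ (i : Fin p) (k : Fin d),
          ‖(Xtᴴ * At k * Xt) i i - lam k‖ ≤
              (‖E k‖ + ‖X₂‖ * ‖Y₂‖ * ‖JointEig.Dmat A₂₂ lam μ k‖) * ε + C * ε ^ 2 ∧
          ‖(Ytᴴ * At k * Xt) i i - lam k‖ ≤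
              JointEig.colNorm Yt i * ‖E k‖ * ε + C * JointEig.colNorm Yt i * ε ^ 2 := by
  have hp : p ≤ n := by
    obtain ⟨-, ⟨Λ, -, hΛ⟩, -⟩ := hlam
    rw [← hΛ]
    simpa using Nat.card_le_card_of_injective
      (Subtype.val : {i : Fin n // Λ i = lam} → Fin n) Subtype.val_injective
  set z := JointEig.linComb μ lam
  set B := JointEig.linComb μ A₂₂ - z • (1 : Matrix (Fin (n - p)) (Fin (n - p)) ℂ)
  have hdet : IsUnit B.det := isUnit_iff_ne_zero.2 (JointEig.det_sub_smul_one_ne_zero hlamμ)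
  have hGB := Matrix.nonsing_inv_mul B hdet
  have hBG := Matrix.mul_nonsing_inv B hdet
  set G := B⁻¹
  have hYX := hXY.conjTranspose_mul_self_right
  have hM := hXY.linComb_sub_smul_one hp μ
  have hAk := hXY.sub_smul_one hp
  -- This radius forces `‖θ i - z‖ * ‖G‖ ≤ 1 / 2`; the `+ 1` covers `G = 0`, as when `n = p`.
  have hδ : 0 < 1 / (2 * (‖G‖ + 1)) := by positivity
  obtain ⟨ε₀, hε₀, hball⟩ := Metric.eventually_nhds_iff.1
    (JointEig.eventually_norm_sub_lt (hXY.pow_dvd_charpoly hp μ) hδ)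
  -- Summing over `k` makes the constants uniform in `k`.
  set S := ∑ k, ‖A₂₂ k - lam k • (1 : Matrix (Fin (n - p)) (Fin (n - p)) ℂ)‖
  set T := ∑ k, ‖A k - lam k • (1 : Matrix (Fin n) (Fin n) ℂ)‖
  have hS (k : Fin d) : ‖A₂₂ k - lam k • (1 : Matrix (Fin (n - p)) (Fin (n - p)) ℂ)‖ ≤ S :=
    Finset.single_le_sum (f := fun k => ‖A₂₂ k - lam k • (1 : Matrix _ _ ℂ)‖)
      (fun _ _ => norm_nonneg _) (Finset.mem_univ k)
  have hT (k : Fin d) : ‖A k - lam k • (1 : Matrix (Fin n) (Fin n) ℂ)‖ ≤ T :=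
    Finset.single_le_sum (f := fun k => ‖A k - lam k • (1 : Matrix _ _ ℂ)‖)
      (fun _ _ => norm_nonneg _) (Finset.mem_univ k)
  have hS0 : 0 ≤ S := Finset.sum_nonneg fun _ _ => norm_nonneg _
  have hT0 : 0 ≤ T := Finset.sum_nonneg fun _ _ => norm_nonneg _
  set C₁ := ‖X₂‖ * S * ‖G‖ * (‖X₂‖ * ‖B‖ * (2 * ‖G‖ * ‖Y₂‖) + 1) * (2 * ‖G‖ * ‖Y₂‖)
  set C₂ := (2 * ‖G‖ * ‖X₂‖) * S * (2 * ‖G‖ * ‖Y₂‖)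
  set C₃ := T / ε₀ ^ 2 with hC₃
  have hC₁0 : 0 ≤ C₁ := by positivity
  have hC₂0 : 0 ≤ C₂ := by positivity
  have hC₃0 : 0 ≤ C₃ := by positivity
  refine ⟨C₁ + C₂ + C₃, fun E hE ε hε At hAt Xt Yt hXt i k => ?_⟩
  obtain ⟨⟨θ, hclose, -, hθX, hθY⟩, hYtXt, hcol⟩ := hXt
  obtain rfl : At = fun k => A k + (ε : ℂ) • E k := funext hAt
  have hF := JointEig.norm_linComb_le_one hμ hE
  rw [JointEig.linComb_add_smul] at hθX hθY hclose
  set F := JointEig.linComb μ E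
  set x := JointEig.colMat Xt i
  set y := JointEig.colMat Yt i
  have hx1 : ‖x‖ = 1 := (JointEig.norm_colMat Xt i).trans (hcol i)
  have hyn : ‖y‖ = JointEig.colNorm Yt i := JointEig.norm_colMat Yt i
  have hη0 : 0 ≤ JointEig.colNorm Yt i := norm_nonneg _
  have hεn : ‖(ε : ℂ)‖ = ε := by rw [Complex.norm_real, Real.norm_of_nonneg hε.le]
  have hXX := JointEig.norm_entry_sub_le (A := A k) (E := E k) (l := lam k) hε
    (JointEig.conjTranspose_mul_self_apply_of_colNorm (hcol i)) (hcol i)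
  have hYX' := JointEig.norm_entry_sub_le (A := A k) (E := E k) (l := lam k) hε
    (Y := Yt) (i := i) (by rw [hYtXt, Matrix.one_apply_eq]) (hcol i)
  rw [hcol i, one_mul] at hXX
  rcases lt_or_ge ε ε₀ with hlt | hge
  · have hθ : ‖θ i - z‖ * ‖G‖ ≤ 1 / 2 := by
      have h1 := hball (y := JointEig.linComb μ A + (ε : ℂ) • F) (by
        rw [dist_eq_norm, add_sub_cancel_left, norm_smul, hεn]
        nlinarith) θ hclose i
      rw [lt_div_iff₀ (by positivity)] at h1
      nlinarith [norm_nonneg (θ i - z)]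
    have hx : (JointEig.linComb μ A + (ε : ℂ) • F) * x = θ i • x := by
      ext a b
      have := congrFun (congrFun hθX a) i
      rw [Matrix.mul_diagonal] at this
      rw [Matrix.smul_apply, smul_eq_mul, mul_comm]
      exact this
    have hy : yᴴ * (JointEig.linComb μ A + (ε : ℂ) • F) = θ i • yᴴ := by
      ext a b
      have := congrFun (congrFun hθY i) b
      rw [Matrix.diagonal_mul] at this
      exact this
    have h1 := JointEig.norm_rayleigh_le hYX hM hGB hF hθ hx hx1
      (A₂₂ k - lam k • (1 : Matrix (Fin (n - p)) (Fin (n - p)) ℂ))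
    have h2 := JointEig.norm_two_sided_rayleigh_le hYX hM hGB hBG hF hθ hx hx1 hy
      (A₂₂ k - lam k • (1 : Matrix (Fin (n - p)) (Fin (n - p)) ℂ))
    rw [← hAk, hεn] at h1 h2
    rw [hyn] at h2
    constructor
    · have h3 : ‖xᴴ * (A k - lam k • (1 : Matrix (Fin n) (Fin n) ℂ)) * x‖ ≤
          ‖X₂‖ * ‖Y₂‖ * ‖JointEig.Dmat A₂₂ lam μ k‖ * ε + C₁ * ε ^ 2 := by
        refine h1.trans ?_
        grw [hS k]
        rfl
      have h4 : C₁ * ε ^ 2 ≤ (C₁ + C₂ + C₃) * ε ^ 2 := by gcongr; linarith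
      linarith
    · have h3 : ‖yᴴ * (A k - lam k • (1 : Matrix (Fin n) (Fin n) ℂ)) * x‖ ≤
          C₂ * JointEig.colNorm Yt i * ε ^ 2 := by
        refine h2.trans ?_
        grw [hS k]
      have h4 : C₂ * JointEig.colNorm Yt i * ε ^ 2 ≤
          (C₁ + C₂ + C₃) * JointEig.colNorm Yt i * ε ^ 2 := by gcongr; linarith
      linarith
  -- For `ε ≥ ε₀` no eigenvector analysis is needed: `T ≤ (T / ε₀ ^ 2) * ε ^ 2`.
  · have hTε : T ≤ (C₁ + C₂ + C₃) * ε ^ 2 := by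
      calc T = C₃ * ε₀ ^ 2 := by rw [hC₃]; field_simp
        _ ≤ C₃ * ε ^ 2 := by gcongr
        _ ≤ _ := by gcongr; linarith
    have hentry (w : Matrix (Fin n) (Fin 1) ℂ) :
        ‖wᴴ * (A k - lam k • (1 : Matrix (Fin n) (Fin n) ℂ)) * x‖ ≤
          ‖w‖ * ((C₁ + C₂ + C₃) * ε ^ 2) := by
      grw [JointEig.norm_mul_mul_le, Matrix.l2_opNorm_conjTranspose, hx1, hT k, hTε, mul_one]
    have h3 := hentry x
    have h4 := hentry y
    rw [hx1, one_mul] at h3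
    rw [hyn] at h4
    constructor
    · have : 0 ≤ ‖X₂‖ * ‖Y₂‖ * ‖JointEig.Dmat A₂₂ lam μ k‖ * ε := by positivity
      linarith
    · linarith
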